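/- **Correspondence language.** Let $\Sigma=\{R,R_\Box,R_\Diamond\}\cup\{P_n\mid n\in\mathbb N\}$ with $R,R_\Box,R_\Diamond$ binary and all $P_n$ unary. A *correspondence formula* is a first-order formula over $\Sigma$ without identity; $\varphi(x)$ means that $\varphi$ has no free variable other than $x$, and $M,a\models\varphi(x)$ means that $\varphi$ holds in $M$ under every assignment sending $x$ to $a$. Put $\Sigma_\varphi=\{R,R_\Box,R_\Diamond\}\cup\{P_n\mid P_n\text{ occurs in }\varphi\}$. **Standard translations.** Modal intuitionistic formulas are built from propositional letters $p_n$ ($n\in\mathbb N$) and $\bot$ by $\wedge,\vee,\to,\Box,\Diamond$. For $i,j\in\{1,2\}$ the $(i,j)$-standard $x$-translation is defined by $ST_{ij}(p_n,x)=P_n(x)$; it commutes with $\bot,\wedge,\vee$; and, with $y,z$ new variables, $$ST_{ij}(I\to J,x)=\forall y(R(x,y)\to(ST_{ij}(I,y)\to ST_{ij}(J,y))),$$ $$ST_{1j}(\Box I,x)=\forall y(R_\Box(x,y)\to ST_{1j}(I,y)),$$ $$ST_{2j}(\Box I,x)=\forall y(R(x,y)\to\forall z(R_\Box(y,z)\to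 ST_{2j}(I,z))),$$ $$ST_{i1}(\Diamond I,x)=\exists y(R_\Diamond(x,y)\wedge ST_{i1}(I,y)),$$ $$ST_{i2}(\Diamond I,x)=\forall y(R(x,y)\to\exists z(R_\Diamond(y,z)\wedge ST_{i2}(I,z))).$$ **Asimulations.** Let $\{R,R_\Box,R_\Diamond\}\subseteq\Theta\subseteq\Sigma$, and let $(M_1,t)$, $(M_2,u)$ be pointed $\Theta$-models with (disjoint) domains $U_1,U_2$. Write $R_k,R_{\Box k},R_{\Diamond k}$ for the interpretations in $M_k$. Consider the following conditions on relations $A,B\subseteq(U_1\times U_2)\cup(U_2\times U_1)$, for all $k,l\in\{1,2\}$, all $a,c\in U_k$, all $b,d,f\in U_l$ and all unary $P\in\Theta$: * (elem) $t\mathrel A u$; * (base) if $a\mathrel A b$ and $M_k,a\models P(x)$ then $M_l,b\models P(x)$; * (step) if $a\mathrel A b$ and $b\mathrel{R_l}d$ then there is $c\in U_k$ with $a\mathrel{R_k}c$, $c\mathrel A d$ and $d\mathrel A c$; * (box-1) if $a\mathrel A b$ and $b\mathrel{R_{\Box l}}d$ then there is $c\in U_k$ with $a\mathrel{R_{\Box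 k}}c$ and $c\mathrel A d$; * (box-2) if $a\mathrel A b$, $b\mathrel{R_l}d$ and $d\mathrel{R_{\Box l}}f$ then there are $c,e\in U_k$ with $a\mathrel{R_k}c$, $c\mathrel{R_{\Box k}}e$ and $e\mathrel A f$; * (diam-1) if $a\mathrel A b$ and $a\mathrel{R_{\Diamond k}}c$ then there is $d\in U_l$ with $b\mathrel{R_{\Diamond l}}d$ and $c\mathrel A d$; * (diam-2(1)) if $a\mathrel A b$ and $b\mathrel{R_l}d$ then there is $c\in U_k$ with $a\mathrel{R_k}c$ and $c\mathrel B d$; * (diam-2(2)) if $a\mathrel B b$ and $a\mathrel{R_{\Diamond k}}c$ then there is $d\in U_l$ with $b\mathrel{R_{\Diamond l}}d$ and $c\mathrel A d$. For $i\in\{1,2\}$, an *$(i,1)$-modal $\langle(M_1,t),(M_2,u)\rangle$-asimulation* is a relation $A$ satisfying (elem), (base), (step), (box-$i$) and (diam-1); an *$(i,2)$-modal $\langle(M_1,t),(M_2,u)\rangle$-asimulation* is a pair $(A,B)$ satisfying (elem), (base), (step), (box-$i$), (diam-2(1)) and (diam-2(2)). A formula $\varphi(x)$ is *invariant with respect to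 $(i,j)$-modal asimulations* if for every $\Theta\supseteq\Sigma_\varphi$, all pointed $\Theta$-models $(M_1,t),(M_2,u)$, every $(i,j)$-modal $\langle(M_1,t),(M_2,u)\rangle$-asimulation $A$ (respectively $(A,B)$ if $j=2$) and all $a\in U_1$, $b\in U_2$: if $a\mathrel A b$ and $M_1,a\models\varphi(x)$ then $M_2,b\models\varphi(x)$. **Theorem.** Let $i,j\in\{1,2\}$. A correspondence formula $\varphi(x)$ is logically equivalent to $ST_{ij}(I,x)$ for some modal intuitionistic formula $I$ if and only if $\varphi(x)$ is invariant with respect to $(i,j)$-modal asimulations. -/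

import Mathlib

open FirstOrder
open FirstOrder.Language (Structure Term)

universe u

/-- The two-element index set `{1, 2}`. It numbers both the two clauses for each modality and the
two models which are compared by an asimulation. -/
inductive Idx : Type
  | one : Idx
  | two : Idx

/-! ### The correspondence language -/

/-- The predicate letters of the correspondence language, sorted by arity: three binary letters
`R`, `R_□`, `R_◇` and unary letters `P_n`. -/
inductive CorrRel : ℕ → Type
  | acc : CorrRel 2
  | box : CorrRel 2
  | dia : CorrRel 2
  | letter (n : ℕ) : CorrRel 1

/-- The correspondence language: no function symbols or constants. -/
abbrev corrLang : FirstOrder.Language.{0, 0} where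
  Functions := fun _ => Empty
  Relations := CorrRel

/-- Correspondence formulas are formulas without identity. -/
def IdentityFree : {n : ℕ} → corrLang.BoundedFormula ℕ n → Prop
  | _, .falsum => True
  | _, .equal _ _ => False
  | _, .rel _ _ => True
  | _, .imp φ ψ => IdentityFree φ ∧ IdentityFree ψ
  | _, .all φ => IdentityFree φ

/-- The index of a unary letter, as a set (empty for the binary letters). -/
def CorrRel.index : {l : ℕ} → CorrRel l → Set ℕ
  | _, .acc => ∅
  | _, .box => ∅
  | _, .dia => ∅
  | _, .letter n => {n}

/-- The set of all `n` such that `P_n` occurs in the formula. -/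
def unaryLetters : {n : ℕ} → corrLang.BoundedFormula ℕ n → Set ℕ
  | _, .falsum => ∅
  | _, .equal _ _ => ∅
  | _, .rel S _ => CorrRel.index S
  | _, .imp φ ψ => unaryLetters φ ∪ unaryLetters ψ
  | _, .all φ => unaryLetters φ

/-! ### Models -/

section Models

variable {M : Type u} [corrLang.Structure M]

/-- The interpretation of `R`. -/
def accRel (a b : M) : Prop := Structure.RelMap (L := corrLang) CorrRel.acc ![a, b]

/-- The interpretation of `R_□`. -/
def boxRel (a b : M) : Prop := Structure.RelMap (L := corrLang) CorrRel.box ![a, b]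

/-- The interpretation of `R_◇`. -/
def diaRel (a b : M) : Prop := Structure.RelMap (L := corrLang) CorrRel.dia ![a, b]

/-- The interpretation of `P_n`. -/
def unaryRel (n : ℕ) (a : M) : Prop :=
  Structure.RelMap (L := corrLang) (CorrRel.letter n) ![a]

/-- Truth of `φ(x)` at the pointed model `(M, a)`: `φ` holds under every assignment which sends
`x` to `a`. -/
def TrueAt (φ : corrLang.Formula ℕ) (x : ℕ) (a : M) : Prop :=
  ∀ v : ℕ → M, v x = a → φ.Realize v

end Models

/-! ### Modal intuitionistic formulas and their standard translations -/

/-- Modal intuitionistic (propositional) formulas. -/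
inductive MIFormula : Type
  | atom (n : ℕ) : MIFormula
  | bot : MIFormula
  | and (I J : MIFormula) : MIFormula
  | or (I J : MIFormula) : MIFormula
  | imp (I J : MIFormula) : MIFormula
  | box (I : MIFormula) : MIFormula
  | dia (I : MIFormula) : MIFormula

section StandardTranslation

variable {n : ℕ}

/-- A variable is a named variable (left) or one bound by one of `n` surrounding quantifiers
(right). `liftVar` is the same variable seen under one more quantifier. -/
def liftVar (x : ℕ ⊕ Fin n) : ℕ ⊕ Fin (n + 1) := Sum.map id Fin.castSucc x

/-- The variable bound by the innermost quantifier. -/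
def newVar : ℕ ⊕ Fin (n + 1) := Sum.inr (Fin.last n)

/-- The atomic formula `S(x, y)` for a binary letter `S`. -/
def atomBin (S : corrLang.Relations 2) (x y : ℕ ⊕ Fin n) : corrLang.BoundedFormula ℕ n :=
  FirstOrder.Language.Relations.boundedFormula₂ (L := corrLang) S (Term.var x) (Term.var y)

/-- The atomic formula `P_m(x)`. -/
def atomUn (m : ℕ) (x : ℕ ⊕ Fin n) : corrLang.BoundedFormula ℕ n :=
  FirstOrder.Language.Relations.boundedFormula₁ (L := corrLang) (CorrRel.letter m) (Term.var x)

end StandardTranslation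

/-- The `(i,j)`-standard translation with respect to a named or bound variable. -/
def stdAux (i j : Idx) : MIFormula → {n : ℕ} → ℕ ⊕ Fin n → corrLang.BoundedFormula ℕ n
  | .atom m, _, x => atomUn m x
  | .bot, _, _ => ⊥
  | .and I J, _, x => stdAux i j I x ⊓ stdAux i j J x
  | .or I J, _, x => stdAux i j I x ⊔ stdAux i j J x
  | .imp I J, _, x =>
      ∀' (atomBin .acc (liftVar x) newVar ⟹ (stdAux i j I newVar ⟹ stdAux i j J newVar))
  | .box I, _, x =>
      match i with
      | .one => ∀' (atomBin .box (liftVar x) newVar ⟹ stdAux i j I newVar)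
      | .two => ∀' (atomBin .acc (liftVar x) newVar ⟹
          ∀' (atomBin .box (liftVar newVar) newVar ⟹ stdAux i j I newVar))
  | .dia I, _, x =>
      match j with
      | .one => ∃' (atomBin .dia (liftVar x) newVar ⊓ stdAux i j I newVar)
      | .two => ∀' (atomBin .acc (liftVar x) newVar ⟹
          ∃' (atomBin .dia (liftVar newVar) newVar ⊓ stdAux i j I newVar))

/-- The `(i,j)`-standard `x`-translation `ST_{ij}(I, x)`. -/
def standardTranslation (i j : Idx) (I : MIFormula) (x : ℕ) : corrLang.Formula ℕ :=
  stdAux i j I (n := 0) (Sum.inl x)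

/-! ### Asimulations -/

section Asimulation

variable {M : Idx → Type u} [∀ i, corrLang.Structure (M i)]

/-- A binary relation on the (disjoint) union of the domains of the two models `M 1` and `M 2`:
`A i j a b` says that `a`, taken from `M i`, is related to `b`, taken from `M j`. -/
abbrev DomRel (M : Idx → Type u) : Type u := ∀ i j : Idx, M i → M j → Prop

/-- The relation is contained in `(U₁ × U₂) ∪ (U₂ × U₁)`. -/
def CrossType (A : DomRel M) : Prop := ∀ i j (a : M i) (b : M j), A i j a b → i ≠ j

/-- The conditions common to all asimulations between `(M 1, t₁)` and `(M 2, t₂)`, over the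
vocabulary consisting of `R`, `R_□`, `R_◇` and all `P_n` with `n ∈ Θ`. Letters outside of this
vocabulary are also interpreted in the structures `M i`, but nothing is required of them, so that
each `M i` stands for its reduct to the vocabulary. -/
structure IsBasicAsimulation (Θ : Set ℕ) (t₁ : M .one) (t₂ : M .two) (A : DomRel M) : Prop where
  type : CrossType A
  elem : A .one .two t₁ t₂
  base : ∀ i j (a : M i) (b : M j), ∀ n ∈ Θ, A i j a b → unaryRel n a → unaryRel n b
  step : ∀ i j (a : M i) (b d : M j), A i j a b → accRel b d →
    ∃ c : M i, accRel a c ∧ A i j c d ∧ A j i d c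

/-- The condition for boxes; it depends on the clause chosen for `□`. -/
def BoxCondition : Idx → DomRel M → Prop
  | .one, A => ∀ i j (a : M i) (b d : M j), A i j a b → boxRel b d →
      ∃ c : M i, boxRel a c ∧ A i j c d
  | .two, A => ∀ i j (a : M i) (b d f : M j), A i j a b → accRel b d → boxRel d f →
      ∃ c e : M i, accRel a c ∧ boxRel c e ∧ A i j e f

/-- The condition for diamonds under the first clause for `◇`. -/
def DiaConditionOne (A : DomRel M) : Prop :=
  ∀ i j (a c : M i) (b : M j), A i j a b → diaRel a c → ∃ d : M j, diaRel b d ∧ A i j c d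

/-- The conditions on the second component of an asimulation under the second clause
for `◇`. -/
structure DiaConditionTwo (A B : DomRel M) : Prop where
  type : CrossType B
  enter : ∀ i j (a : M i) (b d : M j), A i j a b → accRel b d →
    ∃ c : M i, accRel a c ∧ B i j c d
  leave : ∀ i j (a c : M i) (b : M j), B i j a b → diaRel a c →
    ∃ d : M j, diaRel b d ∧ A i j c d

/-- `A` is an `(i,1)`-modal `⟨(M 1, t₁), (M 2, t₂)⟩`-asimulation over `Θ`. -/
structure IsAsimulationOne (i : Idx) (Θ : Set ℕ) (t₁ : M .one) (t₂ : M .two)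
    (A : DomRel M) : Prop where
  basic : IsBasicAsimulation Θ t₁ t₂ A
  box : BoxCondition i A
  dia : DiaConditionOne A

/-- `(A, B)` is an `(i,2)`-modal `⟨(M 1, t₁), (M 2, t₂)⟩`-asimulation over `Θ`. -/
structure IsAsimulationTwo (i : Idx) (Θ : Set ℕ) (t₁ : M .one) (t₂ : M .two)
    (A B : DomRel M) : Prop where
  basic : IsBasicAsimulation Θ t₁ t₂ A
  box : BoxCondition i A
  dia : DiaConditionTwo A B

/-- `A` is an `(i,1)`-modal asimulation, respectively the left component of an `(i,2)`-modal
asimulation. -/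
def IsAsimulationLeft (i j : Idx) (Θ : Set ℕ) (t₁ : M .one) (t₂ : M .two) (A : DomRel M) : Prop :=
  match j with
  | .one => IsAsimulationOne i Θ t₁ t₂ A
  | .two => ∃ B : DomRel M, IsAsimulationTwo i Θ t₁ t₂ A B

end Asimulation

/-- `φ(x)` is invariant with respect to `(i,j)`-modal asimulations (between models over any
vocabulary which contains all letters of `φ`); for `j = 2`, with respect to their left
components. -/
def InvariantUnderAsimulations (i j : Idx) (φ : corrLang.Formula ℕ) (x : ℕ) : Prop :=
  ∀ Θ : Set ℕ, unaryLetters φ ⊆ Θ →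
    ∀ (M : Idx → Type u) [∀ k, corrLang.Structure (M k)] (t₁ : M .one) (t₂ : M .two) (A : DomRel M),
      IsAsimulationLeft i j Θ t₁ t₂ A →
        ∀ (a : M .one) (b : M .two), A .one .two a b → TrueAt φ x a → TrueAt φ x b

/-!
Modal formulas are preserved by asimulations by induction on the formula (`forces_of_asimulation`).
This gives one direction, once the models are replaced by reducts in which the letters outside of the
vocabulary `Θ`, which the asimulation need not respect, are interpreted by the empty set (`Reduct`).

For the other one, suppose that `φ` is invariant but not equivalent to any translation. The set of
translations which `φ` entails is closed under conjunction and none of them entails `φ`; by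
compactness some pointed model `(M₂, u)` satisfies all of them but not `φ`. The set of modal formulas
refuted at `u` is closed under disjunction and none of them is entailed by `φ`, so, by
compactness again, some pointed model `(M₁, t)` of `φ` refutes all of them. Thus every modal formula
true at `t` is true at `u`. If both models are countably saturated, then inclusion of modal types is
an asimulation (`isAsimulationLeft_typeRel`), so that `φ` passes from `t` to `u`, a contradiction.

Compactness and saturation are obtained in a single step: as there are only countably many modal
formulas, both models can be taken to be ultraproducts over `ℕ` of models for larger and larger
finite sets of requirements, and every such ultraproduct is countably saturated. Saturation is
formulated here for internal predicates (`exists_forall_of_internal`), i.e. those which are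
ultraproducts of predicates on the factors.
-/

open Filter

/-! ### Semantics of modal formulas -/

theorem elim_snoc_liftVar {M : Type u} {n : ℕ} (v : ℕ → M) (xs : Fin n → M) (x : ℕ ⊕ Fin n) (b : M) :
    Sum.elim v (Fin.snoc xs b : Fin (n + 1) → M) (liftVar x) = Sum.elim v xs x := by
  cases x with
  | inl m => rfl
  | inr k => exact Fin.snoc_castSucc (α := fun _ => M) b xs k

theorem elim_snoc_newVar {M : Type u} {n : ℕ} (v : ℕ → M) (xs : Fin n → M) (b : M) :
    Sum.elim v (Fin.snoc xs b : Fin (n + 1) → M) newVar = b :=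
  Fin.snoc_last (α := fun _ => M) b xs

section Forcing

variable {M : Type u} [corrLang.Structure M]

/-- Direct satisfaction of a modal formula at a point, with the clauses for `□` and `◇` selected by
`i` and `j`; the standard translation expresses it (`realize_standardTranslation`). -/
def Forces (i j : Idx) : MIFormula → M → Prop
  | .atom n, a => unaryRel n a
  | .bot, _ => False
  | .and I J, a => Forces i j I a ∧ Forces i j J a
  | .or I J, a => Forces i j I a ∨ Forces i j J a
  | .imp I J, a => ∀ b, accRel a b → Forces i j I b → Forces i j J b
  | .box I, a =>
      match i with
      | .one => ∀ b, boxRel a b → Forces i j I b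
      | .two => ∀ b, accRel a b → ∀ c, boxRel b c → Forces i j I c
  | .dia I, a =>
      match j with
      | .one => ∃ b, diaRel a b ∧ Forces i j I b
      | .two => ∀ b, accRel a b → ∃ c, diaRel b c ∧ Forces i j I c

theorem realize_atomUn {n : ℕ} (m : ℕ) (x : ℕ ⊕ Fin n) (v : ℕ → M) (xs : Fin n → M) :
    (atomUn m x).Realize v xs ↔ unaryRel m (Sum.elim v xs x) :=
  FirstOrder.Language.BoundedFormula.realize_rel₁

theorem realize_atomBin {n : ℕ} (S : corrLang.Relations 2) (x y : ℕ ⊕ Fin n) (v : ℕ → M)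
    (xs : Fin n → M) :
    (atomBin S x y).Realize v xs ↔
      Structure.RelMap (L := corrLang) S ![Sum.elim v xs x, Sum.elim v xs y] :=
  FirstOrder.Language.BoundedFormula.realize_rel₂

theorem realize_stdAux (i j : Idx) (I : MIFormula) {n : ℕ} (x : ℕ ⊕ Fin n) (v : ℕ → M)
    (xs : Fin n → M) :
    (stdAux i j I x).Realize v xs ↔ Forces i j I (Sum.elim v xs x) := by
  induction I generalizing n with
  | atom m => exact realize_atomUn m x v xs
  | bot => rfl
  | and I J ihI ihJ => simp [stdAux, Forces, ihI, ihJ]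
  | or I J ihI ihJ => simp [stdAux, Forces, ihI, ihJ]
  | imp I J ihI ihJ =>
    simp [stdAux, Forces, ihI, ihJ, realize_atomBin, elim_snoc_liftVar, elim_snoc_newVar, accRel]
  | box I ih =>
    cases i <;>
    simp [stdAux, Forces, ih, realize_atomBin, elim_snoc_liftVar, elim_snoc_newVar, accRel, boxRel]
  | dia I ih =>
    cases j <;>
    simp [stdAux, Forces, ih, realize_atomBin, elim_snoc_liftVar, elim_snoc_newVar, accRel, diaRel]

theorem realize_standardTranslation (i j : Idx) (I : MIFormula) (x : ℕ) (v : ℕ → M) :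
    (standardTranslation i j I x).Realize v ↔ Forces i j I (v x) :=
  realize_stdAux i j I (Sum.inl x) v _

end Forcing

/-! ### Preservation under asimulations -/

theorem forces_of_asimulation {M : Idx → Type u} [∀ k, corrLang.Structure (M k)] {i j : Idx}
    {t₁ : M .one} {t₂ : M .two} {A : DomRel M}
    (hA : IsAsimulationLeft i j Set.univ t₁ t₂ A) (I : MIFormula) {k l : Idx} {a : M k} {b : M l}
    (hab : A k l a b) (h : Forces i j I a) : Forces i j I b := by
  have hbasic : IsBasicAsimulation Set.univ t₁ t₂ A := by
    cases j
    · exact hA.basic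
    · obtain ⟨B, hB⟩ := hA
      exact hB.basic
  have hbox : BoxCondition i A := by
    cases j
    · exact hA.box
    · obtain ⟨B, hB⟩ := hA
      exact hB.box
  induction I generalizing k l with
  | atom n => exact hbasic.base _ _ _ _ n trivial hab h
  | bot => exact h
  | and I J ihI ihJ => exact ⟨ihI hab h.1, ihJ hab h.2⟩
  | or I J ihI ihJ => exact h.imp (ihI hab) (ihJ hab)
  | imp I J ihI ihJ =>
    intro d hbd hI
    obtain ⟨c, hac, hcd, hdc⟩ := hbasic.step _ _ _ _ _ hab hbd
    exact ihJ hcd (h c hac (ihI hdc hI))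
  | box I ih =>
    cases i with
    | one =>
      intro d hbd
      obtain ⟨c, hac, hcd⟩ := hbox _ _ _ _ _ hab hbd
      exact ih hcd (h c hac)
    | two =>
      intro d hbd f hdf
      obtain ⟨c, e, hac, hce, hef⟩ := hbox _ _ _ _ _ _ hab hbd hdf
      exact ih hef (h c hac e hce)
  | dia I ih =>
    cases j with
    | one =>
      obtain ⟨c, hac, hc⟩ := h
      obtain ⟨d, hbd, hcd⟩ := hA.dia _ _ _ _ _ hab hac
      exact ⟨d, hbd, ih hcd hc⟩
    | two =>
      obtain ⟨B, hB⟩ := id hA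
      intro d hbd
      obtain ⟨c, hac, hcd⟩ := hB.dia.enter _ _ _ _ _ hab hbd
      obtain ⟨e, hce, he⟩ := h c hac
      obtain ⟨f, hdf, hef⟩ := hB.dia.leave _ _ _ _ _ hcd hce
      exact ⟨f, hdf, ih hef he⟩

/-! ### Reducts -/

/-- The reduct of a model to the unary letters in `Θ`, encoded as a structure on the same domain in
which the remaining unary letters are interpreted by the empty set. -/
def Reduct (_Θ : Set ℕ) (M : Type u) : Type u := M

namespace Reduct

variable {Θ : Set ℕ} {M : Type u} [corrLang.Structure M]

instance : corrLang.Structure (Reduct Θ M) where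
  funMap f := f.elim
  RelMap {_} S xs := CorrRel.index S ⊆ Θ ∧ Structure.RelMap (L := corrLang) (M := M) S xs

theorem realize_iff {n : ℕ} (φ : corrLang.BoundedFormula ℕ n) (hid : IdentityFree φ)
    (hΘ : unaryLetters φ ⊆ Θ) (v : ℕ → M) (xs : Fin n → M) :
    φ.Realize (M := Reduct Θ M) v xs ↔ φ.Realize v xs := by
  induction φ with
  | falsum => exact Iff.rfl
  | equal => exact hid.elim
  | rel S ts =>
    have hts : (fun k => (ts k).realize (M := Reduct Θ M) (Sum.elim v xs)) =
        fun k => (ts k).realize (Sum.elim v xs) := by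
      funext k
      cases ts k with
      | var => rfl
      | func f => exact f.elim
    change CorrRel.index S ⊆ Θ ∧ Structure.RelMap (L := corrLang) (M := M) S
      (fun k => (ts k).realize (M := Reduct Θ M) (Sum.elim v xs)) ↔ _
    rw [hts]
    exact and_iff_right hΘ
  | imp φ ψ ihφ ihψ =>
    exact imp_congr (ihφ hid.1 (Set.subset_union_left.trans hΘ) xs)
      (ihψ hid.2 (Set.subset_union_right.trans hΘ) xs)
  | all φ ih => exact forall_congr' fun a => ih hid hΘ (Fin.snoc xs a)

theorem accRel_iff {a b : M} : accRel (M := Reduct Θ M) a b ↔ accRel a b :=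
  and_iff_right (Set.empty_subset Θ)

theorem boxRel_iff {a b : M} : boxRel (M := Reduct Θ M) a b ↔ boxRel a b :=
  and_iff_right (Set.empty_subset Θ)

theorem diaRel_iff {a b : M} : diaRel (M := Reduct Θ M) a b ↔ diaRel a b :=
  and_iff_right (Set.empty_subset Θ)

theorem unaryRel_iff {n : ℕ} {a : M} :
    unaryRel (M := Reduct Θ M) n a ↔ n ∈ Θ ∧ unaryRel n a :=
  and_congr_left fun _ => Set.singleton_subset_iff

end Reduct

/-- Over the reducts, an asimulation respects all unary letters. -/
theorem IsAsimulationLeft.reduct {M : Idx → Type u} [∀ k, corrLang.Structure (M k)] {i j : Idx}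
    {Θ : Set ℕ} {t₁ : M .one} {t₂ : M .two} {A : DomRel M}
    (hA : IsAsimulationLeft i j Θ t₁ t₂ A) :
    IsAsimulationLeft (M := fun k => Reduct Θ (M k)) i j Set.univ t₁ t₂ A := by
  have basic (h : IsBasicAsimulation Θ t₁ t₂ A) :
      IsBasicAsimulation (M := fun k => Reduct Θ (M k)) Set.univ t₁ t₂ A := by
    refine ⟨h.type, h.elem, fun k l a b n _ hab hn => ?_, fun k l a b d hab hbd => ?_⟩
    · have hn := (Reduct.unaryRel_iff (M := M k)).1 hn
      exact (Reduct.unaryRel_iff (M := M l)).2 ⟨hn.1, h.base k l a b n hn.1 hab hn.2⟩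
    · obtain ⟨c, hac, hc⟩ := h.step k l a b d hab ((Reduct.accRel_iff (M := M l)).1 hbd)
      exact ⟨c, (Reduct.accRel_iff (M := M k)).2 hac, hc⟩
  have box (h : BoxCondition i A) : BoxCondition (M := fun k => Reduct Θ (M k)) i A := by
    cases i with
    | one =>
      intro k l a b d hab hbd
      obtain ⟨c, hac, hc⟩ := h k l a b d hab ((Reduct.boxRel_iff (M := M l)).1 hbd)
      exact ⟨c, (Reduct.boxRel_iff (M := M k)).2 hac, hc⟩
    | two =>
      intro k l a b d f hab hbd hdf
      obtain ⟨c, e, hac, hce, he⟩ :=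
        h k l a b d f hab ((Reduct.accRel_iff (M := M l)).1 hbd) ((Reduct.boxRel_iff (M := M l)).1 hdf)
      exact ⟨c, e, (Reduct.accRel_iff (M := M k)).2 hac, (Reduct.boxRel_iff (M := M k)).2 hce, he⟩
  cases j with
  | one =>
    refine ⟨basic hA.basic, box hA.box, fun k l a c b hab hac => ?_⟩
    obtain ⟨d, hbd, hd⟩ := hA.dia k l a c b hab ((Reduct.diaRel_iff (M := M k)).1 hac)
    exact ⟨d, (Reduct.diaRel_iff (M := M l)).2 hbd, hd⟩
  | two =>
    obtain ⟨B, hA⟩ := hA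
    refine ⟨B, basic hA.basic, box hA.box, hA.dia.type, fun k l a b d hab hbd => ?_,
      fun k l a c b hab hac => ?_⟩
    · obtain ⟨c, hac, hc⟩ := hA.dia.enter k l a b d hab ((Reduct.accRel_iff (M := M l)).1 hbd)
      exact ⟨c, (Reduct.accRel_iff (M := M k)).2 hac, hc⟩
    · obtain ⟨d, hbd, hd⟩ := hA.dia.leave k l a c b hab ((Reduct.diaRel_iff (M := M k)).1 hac)
      exact ⟨d, (Reduct.diaRel_iff (M := M l)).2 hbd, hd⟩

/-! ### Enumeration and finite combinations of modal formulas -/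

/-- Gödel numbers of modal formulas. -/
def MIFormula.code : MIFormula → ℕ
  | .atom n => Nat.pair 0 n
  | .bot => Nat.pair 1 0
  | .and I J => Nat.pair 2 (Nat.pair I.code J.code)
  | .or I J => Nat.pair 3 (Nat.pair I.code J.code)
  | .imp I J => Nat.pair 4 (Nat.pair I.code J.code)
  | .box I => Nat.pair 5 I.code
  | .dia I => Nat.pair 6 I.code

theorem MIFormula.code_injective : Function.Injective MIFormula.code := by
  intro I
  induction I with
  | atom n =>
    intro J h
    cases J <;> simp [MIFormula.code, Nat.pair_eq_pair] at h ⊢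
    exact h
  | bot => intro J h; cases J <;> simp [MIFormula.code, Nat.pair_eq_pair] at h ⊢
  | and I₁ I₂ ih₁ ih₂ =>
    intro J h
    cases J <;> simp [MIFormula.code, Nat.pair_eq_pair] at h ⊢
    exact ⟨ih₁ h.1, ih₂ h.2⟩
  | or I₁ I₂ ih₁ ih₂ =>
    intro J h
    cases J <;> simp [MIFormula.code, Nat.pair_eq_pair] at h ⊢
    exact ⟨ih₁ h.1, ih₂ h.2⟩
  | imp I₁ I₂ ih₁ ih₂ =>
    intro J h
    cases J <;> simp [MIFormula.code, Nat.pair_eq_pair] at h ⊢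
    exact ⟨ih₁ h.1, ih₂ h.2⟩
  | box I ih =>
    intro J h
    cases J <;> simp [MIFormula.code, Nat.pair_eq_pair] at h ⊢
    exact ih h
  | dia I ih =>
    intro J h
    cases J <;> simp [MIFormula.code, Nat.pair_eq_pair] at h ⊢
    exact ih h

instance : Countable MIFormula := MIFormula.code_injective.countable

theorem exists_monotone_finset_exhaustion (ι : Type*) [Countable ι] :
    ∃ S : ℕ → Finset ι, Monotone S ∧ ∀ k, ∃ n, k ∈ S n := by
  obtain ⟨e, he⟩ := exists_injective_nat ι
  have hfin (n : ℕ) : (e ⁻¹' Set.Iio n).Finite := (Set.finite_Iio n).preimage he.injOn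
  refine ⟨fun n => (hfin n).toFinset, fun m n hmn k hk => ?_, fun k => ⟨e k + 1, ?_⟩⟩
  · simp only [Set.Finite.mem_toFinset, Set.mem_preimage, Set.mem_Iio] at hk ⊢
    exact hk.trans_le hmn
  · simp

namespace MIFormula

/-- The conjunction of a finite list of modal formulas (`⊥ → ⊥` for the empty list). -/
def conj : List MIFormula → MIFormula
  | [] => .imp .bot .bot
  | I :: l => .and I (conj l)

/-- The disjunction of a finite list of modal formulas (`⊥` for the empty list). -/
def disj : List MIFormula → MIFormula
  | [] => .bot
  | I :: l => .or I (disj l)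

end MIFormula

section

variable {M : Type u} [corrLang.Structure M] {i j : Idx}

theorem forces_conj {l : List MIFormula} {a : M} :
    Forces i j (.conj l) a ↔ ∀ I ∈ l, Forces i j I a := by
  induction l with
  | nil => simp [MIFormula.conj, Forces]
  | cons I l ih => simp [MIFormula.conj, Forces, ih]

theorem forces_disj {l : List MIFormula} {a : M} :
    Forces i j (.disj l) a ↔ ∃ I ∈ l, Forces i j I a := by
  induction l with
  | nil => simp [MIFormula.disj, Forces]
  | cons I l ih => simp [MIFormula.disj, Forces, ih]

end

/-! ### Saturation of ultraproducts over the natural numbers -/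

section Internal

variable {X : ℕ → Type u} {U : Ultrafilter ℕ}

/-- A predicate on an ultraproduct is internal if it is the ultraproduct of predicates on the
factors. -/
def IsInternal (Q : (U : Filter ℕ).Product X → Prop) : Prop :=
  ∃ P : ∀ s, X s → Prop, ∀ c : ∀ s, X s,
    Q (c : (U : Filter ℕ).Product X) ↔ ∀ᶠ s in (U : Filter ℕ), P s (c s)

theorem IsInternal.not {Q : (U : Filter ℕ).Product X → Prop} (h : IsInternal Q) :
    IsInternal fun c => ¬ Q c := by
  obtain ⟨P, hP⟩ := h
  exact ⟨fun s x => ¬ P s x, fun c => (not_congr (hP c)).trans Ultrafilter.eventually_not.symm⟩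

/-- Internal binary relations on an ultraproduct. -/
def IsInternalRel (Q : (U : Filter ℕ).Product X → (U : Filter ℕ).Product X → Prop) : Prop :=
  ∃ P : ∀ s, X s → X s → Prop, ∀ c d : ∀ s, X s,
    Q (c : (U : Filter ℕ).Product X) (d : (U : Filter ℕ).Product X) ↔
      ∀ᶠ s in (U : Filter ℕ), P s (c s) (d s)

theorem IsInternalRel.apply {Q : (U : Filter ℕ).Product X → (U : Filter ℕ).Product X → Prop}
    (h : IsInternalRel Q) (a : (U : Filter ℕ).Product X) : IsInternal (Q a) := by
  obtain ⟨P, hP⟩ := h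
  obtain ⟨a, rfl⟩ := Quotient.exists_rep a
  exact ⟨fun s => P s (a s), fun c => hP a c⟩

theorem IsInternalRel.swap {Q : (U : Filter ℕ).Product X → (U : Filter ℕ).Product X → Prop}
    (h : IsInternalRel Q) : IsInternalRel fun a b => Q b a := by
  obtain ⟨P, hP⟩ := h
  exact ⟨fun s x y => P s y x, fun c d => hP d c⟩

/-- Witnesses for an internal existential statement can be chosen factor by factor. -/
theorem IsInternalRel.exists_and [∀ s, Nonempty (X s)]
    {Q : (U : Filter ℕ).Product X → (U : Filter ℕ).Product X → Prop}
    {Q' : (U : Filter ℕ).Product X → Prop} (h : IsInternalRel Q) (h' : IsInternal Q') :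
    IsInternal fun c => ∃ d, Q c d ∧ Q' d := by
  obtain ⟨P, hP⟩ := h
  obtain ⟨P', hP'⟩ := h'
  refine ⟨fun s x => ∃ y, P s x y ∧ P' s y, fun c => ⟨?_, fun hc => ?_⟩⟩
  · rintro ⟨d, hd, hd'⟩
    obtain ⟨d, rfl⟩ := Quotient.exists_rep d
    filter_upwards [(hP c d).1 hd, (hP' d).1 hd'] with s h1 h2
    exact ⟨d s, h1, h2⟩
  · have hex : ∀ s, ∃ y, (∃ y, P s (c s) y ∧ P' s y) → P s (c s) y ∧ P' s y := fun s => by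
      by_cases hs : ∃ y, P s (c s) y ∧ P' s y
      · exact ⟨hs.choose, fun _ => hs.choose_spec⟩
      · exact ⟨Classical.arbitrary _, fun h => (hs h).elim⟩
    choose d hd using hex
    exact ⟨(d : (U : Filter ℕ).Product X), (hP c d).2 (hc.mono fun s hs => (hd s hs).1),
      (hP' d).2 (hc.mono fun s hs => (hd s hs).2)⟩

/-- Countable saturation: countably many internal predicates which can be satisfied finitely many
at a time, together with `Q₀`, can be satisfied simultaneously. -/
theorem exists_forall_of_internal [∀ s, Nonempty (X s)] (hU : (U : Filter ℕ) ≤ atTop)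
    {ι : Type*} [Countable ι] {Q₀ : (U : Filter ℕ).Product X → Prop}
    {Q : ι → (U : Filter ℕ).Product X → Prop} (h₀ : IsInternal Q₀) (hQ : ∀ k, IsInternal (Q k))
    (hfin : ∀ F : Finset ι, ∃ c, Q₀ c ∧ ∀ k ∈ F, Q k c) : ∃ c, Q₀ c ∧ ∀ k, Q k c := by
  classical
  obtain ⟨P₀, hP₀⟩ := h₀
  choose P hP using hQ
  obtain ⟨S, hSmono, hS⟩ := exists_monotone_finset_exhaustion ι
  -- `G n s` says that the first `n` requirements can be met in the factor `X s`.
  let G : ℕ → ℕ → Prop := fun n s => ∃ x, P₀ s x ∧ ∀ k ∈ S n, P k s x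
  have hG (n : ℕ) : ∀ᶠ s in (U : Filter ℕ), G n s := by
    obtain ⟨c, hc₀, hc⟩ := hfin (S n)
    obtain ⟨c, rfl⟩ := Quotient.exists_rep c
    have hall : ∀ᶠ s in (U : Filter ℕ), ∀ k ∈ S n, P k s (c s) :=
      (Finset.eventually_all (S n)).2 fun k hk => (hP k c).1 (hc k hk)
    filter_upwards [(hP₀ c).1 hc₀, hall] with s h1 h2
    exact ⟨c s, h1, h2⟩
  -- In the factor `X s`, meet the first `n` requirements for the largest possible `n ≤ s`.
  let N : ℕ → ℕ := fun s => Nat.findGreatest (fun n => G n s) s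
  have hex : ∀ s, ∃ x, G (N s) s → P₀ s x ∧ ∀ k ∈ S (N s), P k s x := fun s => by
    by_cases hs : G (N s) s
    · exact ⟨hs.choose, fun _ => hs.choose_spec⟩
    · exact ⟨Classical.arbitrary _, fun h => (hs h).elim⟩
  choose c hc using hex
  have key (n : ℕ) : ∀ᶠ s in (U : Filter ℕ), P₀ s (c s) ∧ ∀ k ∈ S n, P k s (c s) := by
    filter_upwards [hG n, hU (eventually_ge_atTop n)] with s hs hns
    have hspec : G (N s) s := Nat.findGreatest_spec (P := fun n => G n s) hns hs
    have hle : n ≤ N s := Nat.le_findGreatest hns hs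
    exact ⟨(hc s hspec).1, fun k hk => (hc s hspec).2 k (hSmono hle hk)⟩
  refine ⟨(c : (U : Filter ℕ).Product X), (hP₀ c).2 ((key 0).mono fun s hs => hs.1), fun k => ?_⟩
  obtain ⟨n, hn⟩ := hS k
  exact (hP k c).2 ((key n).mono fun s hs => hs.2 k hn)

variable [∀ s, corrLang.Structure (X s)]

theorem isInternalRel_relMap (S : corrLang.Relations 2) :
    IsInternalRel (X := X) (U := U) fun a b => Structure.RelMap (L := corrLang) S ![a, b] := by
  refine ⟨fun s a b => Structure.RelMap (L := corrLang) S ![a, b], fun c d => ?_⟩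
  have h : (![(c : (U : Filter ℕ).Product X), (d : (U : Filter ℕ).Product X)]) =
      fun k => ((![c, d] k : ∀ s, X s) : (U : Filter ℕ).Product X) := by
    funext k; fin_cases k <;> rfl
  have h' (s : ℕ) : ![c s, d s] = fun k => (![c, d] k : ∀ s, X s) s := by
    funext k; fin_cases k <;> rfl
  simp only [h']
  exact (iff_of_eq (congrArg (Structure.RelMap (L := corrLang) S) h)).trans
    (FirstOrder.Language.relMap_quotient_mk' ((U : Filter ℕ).productSetoid X) S ![c, d])

theorem isInternalRel_accRel : IsInternalRel (X := X) (U := U) accRel := isInternalRel_relMap _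

theorem isInternalRel_boxRel : IsInternalRel (X := X) (U := U) boxRel := isInternalRel_relMap _

theorem isInternalRel_diaRel : IsInternalRel (X := X) (U := U) diaRel := isInternalRel_relMap _

/-- Łoś's theorem for standard translations. -/
theorem isInternal_forces [∀ s, Nonempty (X s)] (i j : Idx) (I : MIFormula) :
    IsInternal (X := X) (U := U) (Forces i j I) := by
  refine ⟨fun s => Forces i j I, fun c => ?_⟩
  have h := FirstOrder.Language.Ultraproduct.realize_formula_cast (u := U)
    (standardTranslation i j I 0) (fun _ => c)
  simp only [realize_standardTranslation (M := X _)] at h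
  exact (realize_standardTranslation (M := (U : Filter ℕ).Product X) i j I 0 _).symm.trans h

end Internal

/-! ### Inclusion of types is an asimulation -/

section TypeRel

/-- Inclusion of modal types: every modal formula true at the first point is true at the second
one. -/
def typeRel (M : Idx → Type u) [∀ k, corrLang.Structure (M k)] (i j : Idx) : DomRel M :=
  fun k l a b => k ≠ l ∧ ∀ I, Forces i j I a → Forces i j I b

/-- Inclusion of diamond types: every modal formula true at some `R_◇`-successor of the first point
is true at some `R_◇`-successor of the second one. -/
def diaTypeRel (M : Idx → Type u) [∀ k, corrLang.Structure (M k)] (i j : Idx) : DomRel M :=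
  fun k l a b => k ≠ l ∧
    ∀ I, (∃ c, diaRel a c ∧ Forces i j I c) → ∃ d, diaRel b d ∧ Forces i j I d

variable {X : Idx → ℕ → Type u} [∀ k s, corrLang.Structure (X k s)] [∀ k s, Nonempty (X k s)]
  {U : Ultrafilter ℕ}

theorem isAsimulationLeft_typeRel (hU : (U : Filter ℕ) ≤ atTop) (i j : Idx)
    (t₁ : (U : Filter ℕ).Product (X .one)) (t₂ : (U : Filter ℕ).Product (X .two))
    (ht : ∀ I, Forces i j I t₁ → Forces i j I t₂) :
    IsAsimulationLeft (M := fun k => (U : Filter ℕ).Product (X k)) i j Set.univ t₁ t₂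
      (typeRel _ i j) := by
  classical
  have basic : IsBasicAsimulation (M := fun k => (U : Filter ℕ).Product (X k)) Set.univ t₁ t₂
      (typeRel _ i j) := by
    refine ⟨fun k l a b h => h.1, ⟨by simp, ht⟩, fun k l a b n _ h => h.2 (.atom n), ?_⟩
    rintro k l a b d ⟨hkl, hab⟩ hbd
    obtain ⟨c, hac, hc⟩ : ∃ c, accRel a c ∧ ∀ I, Forces i j I c ↔ Forces i j I d := by
      refine exists_forall_of_internal hU (isInternalRel_accRel.apply a)
        (fun I => ?_) fun F => ?_
      · by_cases hI : Forces i j I d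
        · simpa only [hI, iff_true] using isInternal_forces i j I
        · simpa only [hI, iff_false] using (isInternal_forces i j I).not
      -- The implication from the formulas of `F` true at `d` to those false at `d` fails at `b`.
      · by_contra! hno
        have h := hab (.imp (.conj (F.toList.filter fun I => Forces i j I d))
          (.disj (F.toList.filter fun I => ¬ Forces i j I d))) (fun c hac hc => by
            obtain ⟨I, hIF, hI⟩ := hno c hac
            rcases hI with hI | hI
            · exact forces_disj.2 ⟨I, by simp [hIF, hI.2], hI.1⟩
            · exact (hI.1 (forces_conj.1 hc I (by simp [hIF, hI.2]))).elim)
          d hbd (forces_conj.2 (by simp))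
        obtain ⟨I, hI, hId⟩ := forces_disj.1 h
        simp [hId] at hI
    exact ⟨c, hac, ⟨hkl, fun I => (hc I).1⟩, ⟨hkl.symm, fun I => (hc I).2⟩⟩
  have box : BoxCondition (M := fun k => (U : Filter ℕ).Product (X k)) i (typeRel _ i j) := by
    cases i with
    | one =>
      rintro k l a b d ⟨hkl, hab⟩ hbd
      obtain ⟨c, hac, hc⟩ : ∃ c, boxRel a c ∧
          ∀ I : {I : MIFormula // ¬ Forces .one j I d}, ¬ Forces .one j I.1 c := by
        refine exists_forall_of_internal hU (isInternalRel_boxRel.apply a)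
          (fun I => (isInternal_forces _ j I.1).not) fun F => ?_
        by_contra! hno
        have h := hab (.box (.disj (F.toList.map Subtype.val))) (fun c hac => by
          obtain ⟨I, hIF, hI⟩ := hno c hac
          exact forces_disj.2 ⟨I.1, by simpa using ⟨I.2, hIF⟩, hI⟩) d hbd
        obtain ⟨I, hI, hId⟩ := forces_disj.1 h
        obtain ⟨I, -, rfl⟩ := List.mem_map.1 hI
        exact I.2 hId
      exact ⟨c, hac, hkl, fun I hI => by_contra fun hd => hc ⟨I, hd⟩ hI⟩
    | two =>
      rintro k l a b d f ⟨hkl, hab⟩ hbd hdf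
      obtain ⟨e, ⟨c, hce, hac⟩, he⟩ : ∃ e, (∃ c, boxRel c e ∧ accRel a c) ∧
          ∀ I : {I : MIFormula // ¬ Forces .two j I f}, ¬ Forces .two j I.1 e := by
        refine exists_forall_of_internal hU
          (isInternalRel_boxRel.swap.exists_and (isInternalRel_accRel.apply a))
          (fun I => (isInternal_forces _ j I.1).not) fun F => ?_
        by_contra! hno
        have h := hab (.box (.disj (F.toList.map Subtype.val))) (fun c hac e hce => by
          obtain ⟨I, hIF, hI⟩ := hno e ⟨c, hce, hac⟩
          exact forces_disj.2 ⟨I.1, by simpa using ⟨I.2, hIF⟩, hI⟩) d hbd f hdf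
        obtain ⟨I, hI, hIf⟩ := forces_disj.1 h
        obtain ⟨I, -, rfl⟩ := List.mem_map.1 hI
        exact I.2 hIf
      exact ⟨c, e, hac, hce, hkl, fun I hI => by_contra fun hf => he ⟨I, hf⟩ hI⟩
  -- Saturation at diamond successors, the same for both clauses.
  have diaSucc (k l : Idx) (a c : (U : Filter ℕ).Product (X k)) (b : (U : Filter ℕ).Product (X l))
      (hab : ∀ I, (∃ c, diaRel a c ∧ Forces i j I c) → ∃ d, diaRel b d ∧ Forces i j I d)
      (hac : diaRel a c) : ∃ d, diaRel b d ∧ ∀ I, Forces i j I c → Forces i j I d := by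
    obtain ⟨d, hbd, hd⟩ : ∃ d, diaRel b d ∧
        ∀ I : {I : MIFormula // Forces i j I c}, Forces i j I.1 d := by
      refine exists_forall_of_internal hU (isInternalRel_diaRel.apply b)
        (fun I => isInternal_forces i j I.1) fun F => ?_
      obtain ⟨d, hbd, hd⟩ := hab (.conj (F.toList.map Subtype.val)) ⟨c, hac, forces_conj.2 (by
        intro I hI
        obtain ⟨I, -, rfl⟩ := List.mem_map.1 hI
        exact I.2)⟩
      exact ⟨d, hbd, fun I hI =>
        forces_conj.1 hd I.1 (List.mem_map_of_mem (Finset.mem_toList.2 hI))⟩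
    exact ⟨d, hbd, fun I hI => hd ⟨I, hI⟩⟩
  cases j with
  | one =>
    refine ⟨basic, box, ?_⟩
    rintro k l a c b ⟨hkl, hab⟩ hac
    obtain ⟨d, hbd, hd⟩ := diaSucc k l a c b (fun I => hab (.dia I)) hac
    exact ⟨d, hbd, hkl, hd⟩
  | two =>
    refine ⟨diaTypeRel _ i .two, basic, box, fun k l a b h => h.1, ?_, ?_⟩
    · rintro k l a b d ⟨hkl, hab⟩ hbd
      obtain ⟨c, hac, hc⟩ : ∃ c, accRel a c ∧
          ∀ I : {I : MIFormula // ¬ ∃ e, diaRel d e ∧ Forces i .two I e},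
            ¬ ∃ e, diaRel c e ∧ Forces i .two I.1 e := by
        refine exists_forall_of_internal hU (isInternalRel_accRel.apply a)
          (fun I => (isInternalRel_diaRel.exists_and (isInternal_forces i .two I.1)).not)
          fun F => ?_
        by_contra! hno
        obtain ⟨e, hde, he⟩ := hab (.dia (.disj (F.toList.map Subtype.val))) (fun c hac => by
          obtain ⟨I, hIF, e, hce, hI⟩ := hno c hac
          exact ⟨e, hce, forces_disj.2
            ⟨I.1, List.mem_map_of_mem (Finset.mem_toList.2 hIF), hI⟩⟩) d hbd
        obtain ⟨I, hI, hIe⟩ := forces_disj.1 he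
        obtain ⟨I, -, rfl⟩ := List.mem_map.1 hI
        exact I.2 ⟨e, hde, hIe⟩
      exact ⟨c, hac, hkl, fun I hI => by_contra fun hd => hc ⟨I, hd⟩ hI⟩
    · rintro k l a c b ⟨hkl, hab⟩ hac
      obtain ⟨d, hbd, hd⟩ := diaSucc k l a c b hab hac
      exact ⟨d, hbd, hkl, hd⟩

end TypeRel

/-! ### Compactness and the characterization -/

/-- Entailment over nonempty structures does not depend on the universe in which the structures are
taken. -/
theorem imp_of_forall_realize {φ ψ : corrLang.Formula ℕ}
    (h : ∀ (M : Type u) [corrLang.Structure M] (v : ℕ → M), φ.Realize v → ψ.Realize v) :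
    φ ⟹[(∅ : corrLang.Theory)] ψ := by
  intro M v xs
  let e : M ≃ ULift.{u} M := Equiv.ulift.symm
  let : corrLang.Structure (ULift.{u} M) := e.inducedStructure
  have key (θ : corrLang.Formula ℕ) : θ.Realize (e ∘ v) ↔ θ.Realize v :=
    FirstOrder.Language.StrongHomClass.realize_formula e.inducedStructureEquiv θ
  rw [FirstOrder.Language.BoundedFormula.realize_imp, Subsingleton.elim xs default]
  exact fun hφ => (key ψ).1 (h _ _ ((key φ).2 hφ))

theorem trueAt_iff {M : Type u} [corrLang.Structure M] {φ : corrLang.Formula ℕ} {x : ℕ}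
    (hfree : φ.freeVarFinset ⊆ {x}) (v : ℕ → M) : TrueAt φ x (v x) ↔ φ.Realize v := by
  refine ⟨fun h => h v rfl, fun h w hw => ?_⟩
  have hs : (φ.freeVarFinset : Set ℕ) ⊆ {x} := by
    simpa using Finset.coe_subset.2 hfree
  have hvw : w ∘ ((↑) : ({x} : Set ℕ) → ℕ) = v ∘ (↑) := by
    funext y
    obtain ⟨y, rfl⟩ := y
    exact hw
  have hw' := FirstOrder.Language.BoundedFormula.realize_restrictFreeVar' (φ := φ) hs
    (v := w) (xs := default)
  have hv' := FirstOrder.Language.BoundedFormula.realize_restrictFreeVar' (φ := φ) hs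
    (v := v) (xs := default)
  rw [hvw] at hw'
  exact hw'.1 (hv'.2 h)

/-- Compactness for countable sets of formulas, with a countably saturated model: an ultraproduct
over a nonprincipal ultrafilter on `ℕ`. -/
theorem exists_ultraproduct_realize {ι : Type*} [Countable ι] (ψ₀ : corrLang.Formula ℕ)
    (ψ : ι → corrLang.Formula ℕ)
    (h : ∀ F : Finset ι, ∃ (M : Type u) (_ : corrLang.Structure M) (v : ℕ → M),
      ψ₀.Realize v ∧ ∀ k ∈ F, (ψ k).Realize v) :
    ∃ (X : ℕ → Type u) (_ : ∀ s, corrLang.Structure (X s)) (_ : ∀ s, Nonempty (X s))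
      (v : ℕ → (hyperfilter ℕ : Filter ℕ).Product X), ψ₀.Realize v ∧ ∀ k, (ψ k).Realize v := by
  obtain ⟨S, hSmono, hS⟩ := exists_monotone_finset_exhaustion ι
  choose X inst v hv₀ hv using fun s => h (S s)
  have hne : ∀ s, Nonempty (X s) := fun s => ⟨v s 0⟩
  refine ⟨X, inst, hne, fun m => ((fun s => v s m : ∀ s, X s) :
    (hyperfilter ℕ : Filter ℕ).Product X), ?_, fun k => ?_⟩
  · exact (FirstOrder.Language.Ultraproduct.realize_formula_cast ψ₀ _).2 (.of_forall hv₀)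
  · refine (FirstOrder.Language.Ultraproduct.realize_formula_cast (ψ k) _).2 ?_
    obtain ⟨n, hn⟩ := hS k
    filter_upwards [Nat.hyperfilter_le_atTop (eventually_ge_atTop n)] with s hs
    exact hv s k (hSmono hs hn)

theorem invariant_of_iff_standardTranslation {i j : Idx} {x : ℕ} {φ : corrLang.Formula ℕ}
    (hid : IdentityFree φ) {I : MIFormula}
    (hI : φ ⇔[(∅ : corrLang.Theory)] standardTranslation i j I x) :
    InvariantUnderAsimulations.{u} i j φ x := by
  intro Θ hΘ M _ t₁ t₂ A hA a b hab ha v hv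
  -- `I` may contain letters outside of `Θ`, which `A` need not respect in the given models.
  have key (k : Idx) (w : ℕ → M k) :
      φ.Realize w ↔ Forces (M := Reduct Θ (M k)) i j I (w x) := by
    have : Nonempty (Reduct Θ (M k)) := ⟨w 0⟩
    have h := hI.realize_boundedFormula (Reduct Θ (M k)) (v := w) (xs := default)
    replace h := (FirstOrder.Language.BoundedFormula.realize_iff (M := Reduct Θ (M k))).1 h
    exact (Reduct.realize_iff φ hid hΘ w _).symm.trans
      (h.trans (realize_standardTranslation (M := Reduct Θ (M k)) i j I x w))
  rw [key, hv]
  exact forces_of_asimulation hA.reduct I hab ((key .one fun _ => a).1 (ha _ rfl))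

theorem exists_iff_standardTranslation {i j : Idx} {x : ℕ} {φ : corrLang.Formula ℕ}
    (hfree : φ.freeVarFinset ⊆ {x}) (hinv : InvariantUnderAsimulations.{u} i j φ x) :
    ∃ I : MIFormula, φ ⇔[(∅ : corrLang.Theory)] standardTranslation i j I x := by
  classical
  by_contra! hno
  obtain ⟨X₂, _, _, v₂, hv₂, hcons⟩ := exists_ultraproduct_realize.{u} φ.not
    (fun I : {I : MIFormula // ∀ (M : Type u) [corrLang.Structure M] (v : ℕ → M),
      φ.Realize v → Forces i j I (v x)} => standardTranslation i j I.1 x) (by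
    intro F
    by_contra! hF
    refine hno (.conj (F.toList.map Subtype.val)) (FirstOrder.Language.Theory.imp_antisymm
      (imp_of_forall_realize.{u} fun M _ v hφ => ?_) (imp_of_forall_realize.{u} fun M _ v hI => ?_))
    · rw [realize_standardTranslation, forces_conj]
      intro I hI
      obtain ⟨I, -, rfl⟩ := List.mem_map.1 hI
      exact I.2 M v hφ
    · rw [realize_standardTranslation, forces_conj] at hI
      by_contra hφ
      obtain ⟨I, hIF, hIv⟩ := hF M _ v hφ
      exact hIv ((realize_standardTranslation i j I.1 x v).2
        (hI I.1 (List.mem_map_of_mem (Finset.mem_toList.2 hIF)))))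
  obtain ⟨X₁, _, _, v₁, hv₁, hfail⟩ := exists_ultraproduct_realize.{u} φ
    (fun I : {I : MIFormula // ¬ Forces i j I (v₂ x)} => (standardTranslation i j I.1 x).not) (by
    intro F
    by_contra! hF
    have h := hcons ⟨.disj (F.toList.map Subtype.val), fun M _ v hφ => by
      obtain ⟨I, hIF, hIv⟩ := hF M _ v hφ
      rw [FirstOrder.Language.Formula.realize_not, not_not, realize_standardTranslation] at hIv
      exact forces_disj.2 ⟨I.1, List.mem_map_of_mem (Finset.mem_toList.2 hIF), hIv⟩⟩
    obtain ⟨I, hI, hIv⟩ := forces_disj.1 ((realize_standardTranslation _ _ _ _ _).1 h)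
    obtain ⟨I, -, rfl⟩ := List.mem_map.1 hI
    exact I.2 hIv)
  let X : Idx → ℕ → Type u := fun k => match k with
    | .one => X₁
    | .two => X₂
  let : ∀ k s, corrLang.Structure (X k s) := fun k => match k with
    | .one => inferInstanceAs (∀ s, corrLang.Structure (X₁ s))
    | .two => inferInstanceAs (∀ s, corrLang.Structure (X₂ s))
  have : ∀ k s, Nonempty (X k s) := fun k => match k with
    | .one => inferInstanceAs (∀ s, Nonempty (X₁ s))
    | .two => inferInstanceAs (∀ s, Nonempty (X₂ s))
  have ht : ∀ I, Forces i j I (v₁ x) → Forces i j I (v₂ x) := fun I h₁ => by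
    by_contra h₂
    exact hfail ⟨I, h₂⟩ ((realize_standardTranslation i j I x v₁).2 h₁)
  have hA := isAsimulationLeft_typeRel (X := X) Nat.hyperfilter_le_atTop i j (v₁ x) (v₂ x) ht
  have h := hinv Set.univ (Set.subset_univ _) (fun k => (hyperfilter ℕ : Filter ℕ).Product (X k))
    (v₁ x) (v₂ x) _ hA (v₁ x) (v₂ x) ⟨by simp, ht⟩ ((trueAt_iff hfree v₁).2 hv₁)
  exact hv₂ ((trueAt_iff hfree v₂).1 h)

theorem theorem2 (i j : Idx) (x : ℕ) (φ : corrLang.Formula ℕ) (hid : IdentityFree φ)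
    (hfree : φ.freeVarFinset ⊆ {x}) :
    (∃ I : MIFormula, φ ⇔[(∅ : corrLang.Theory)] standardTranslation i j I x) ↔
      InvariantUnderAsimulations.{u} i j φ x :=
  ⟨fun ⟨_, hI⟩ => invariant_of_iff_standardTranslation hid hI,
    exists_iff_standardTranslation hfree⟩
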